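/- Let $X$ be a separable, infinite-dimensional Banach space over $\mathbb{R}$ or $\mathbb{C}$, and let $\mathcal{B}(X)$ be the algebra of bounded linear operators on $X$. For $T_1,\dots,T_M\in\mathcal{B}(X)$, $M\ge 1$, let $\mathrm{d}\text{-}\mathcal{HC}(T_1,\dots,T_M)$ be the set of all $x\in X$ such that $\{(T_1^nx,\dots,T_M^nx): n\in\mathbb{N}\}$ is dense in $X^M$; call $T_1,\dots,T_M$ densely d-hypercyclic if $\mathrm{d}\text{-}\mathcal{HC}(T_1,\dots,T_M)$ is dense in $X$. A subset of $\mathcal{B}(X)$ is SOT-dense if it is dense in $\mathcal{B}(X)$ for the strong operator topology (the topology of pointwise norm convergence on $X$). Let $N\ge 1$ and let $T_1,\dots,T_N\in\mathcal{B}(X)$ be densely d-hypercyclic. Then the collection $$\mathcal{D}=\{T\in\mathcal{B}(X): T_1,\dots,T_N,T \text{ are densely d-hypercyclic}\}$$ is SOT-dense in $\mathcal{B}(X)$. Moreover, for every countable (possibly finite) linearly independent set $\mathcal{A}\subseteq \mathrm{d}\text{-}\mathcal{HC}(T_1,\dots,T_N)$ there is an SOT-dense subcollection $\mathcal{C}\subseteq\mathcal{D}$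 such that $\mathcal{A}\subseteq \mathrm{d}\text{-}\mathcal{HC}(T_1,\dots,T_N,T)$ for every $T\in\mathcal{C}$. -/

import Mathlib

namespace DisjointHypercyclic

variable {𝕜 X : Type*} [RCLike 𝕜] [NormedAddCommGroup X] [NormedSpace 𝕜 X]

/-- The set of d-hypercyclic vectors of `T 0, …, T (N - 1)`: the vectors `x` for which
`{(T 0 ^ n x, …, T (N - 1) ^ n x) : n ∈ ℕ}` is dense in `X ^ N`. -/
def dHC {N : ℕ} (T : Fin N → X →L[𝕜] X) : Set X :=
  {x | Dense (Set.range fun n : ℕ => fun i : Fin N => (T i ^ n) x)}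

/-- The operators `T 0, …, T (N - 1)` are densely d-hypercyclic. -/
def DenselyDHypercyclic {N : ℕ} (T : Fin N → X →L[𝕜] X) : Prop :=
  Dense (dHC T)

/-- The tuple `T 0, …, T (N - 1), S`. -/
def extend {N : ℕ} (T : Fin N → X →L[𝕜] X) (S : X →L[𝕜] X) : Fin (N + 1) → X →L[𝕜] X :=
  Fin.snoc (α := fun _ => X →L[𝕜] X) T S

/-- A set of bounded operators is SOT-dense if it is dense for the topology of pointwise
convergence on `X`, which Mathlib puts on the type synonym `X →Lₚₜ[𝕜] X`. -/
def SOTDense (S : Set (X →L[𝕜] X)) : Prop :=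
  Dense (ContinuousLinearMap.toPointwiseConvergenceCLM 𝕜 (RingHom.id 𝕜) X X '' S)

end DisjointHypercyclic

/-!
Fix a mixing operator `S` on `X`; then some conjugate `L⁻¹ S L` serves as the additional operator.

* Such an `S` exists: `X` carries a bounded `K` with a chain `⋯ ↦ r 2 ↦ r 1 ↦ r 0 ↦ 0` of dense
  span. On that span `exp K` acts as the translation `p(t) ↦ p(t + 1)` of polynomials, and the
  perturbation `t ^ k (1 - t / n) ^ (k + 1)` of `t ^ k` is sent to something small by the `n`-th
  power of the translation. The same holds for `exp (-K)`, so a Kitai-type criterion applies.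
* If `x ≠ 0` is d-hypercyclic for `T`, then `L ↦ L x` is open on the group of invertible operators,
  so by mixing and Baire's theorem `x` is d-hypercyclic for `T, L⁻¹ S L` for residually many `L`.
  This can be achieved for countably many `x` at once.
* The conjugates of `S` are SOT-dense: given `R` and independent `b i`, perturb the `R (b i)` to
  `c i` so that all `b i`, `c i` are independent. Since `S` admits independent `e i`, `S (e i)`,
  some invertible `L` maps `b i` to `e i` and `c i` to `S (e i)`, whence `L⁻¹ S L (b i) = c i`.
-/

namespace DisjointHypercyclic

open Filter Topology Set Polynomial

section LinearAlgebra

variable {K V : Type*} [Field K] [AddCommGroup V] [Module K V]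

theorem linearIndependent_pow_apply {f : Module.End K V} {x : V}
    (hx : ¬ FiniteDimensional K (Submodule.span K (range fun n : ℕ => (f ^ n) x))) :
    LinearIndependent K fun n : ℕ => (f ^ n) x := by
  rw [linearIndependent_powers_iff_aeval]
  intro p hp
  by_contra hp0
  let evalAt : K[X] →ₗ[K] V := LinearMap.applyₗ x ∘ₗ (aeval f).toLinearMap
  have mod_eq (q : K[X]) : evalAt (q % p) = evalAt q := by
    nth_rw 2 [← EuclideanDomain.div_add_mod' q p]
    simp [evalAt, hp]
  have orbit_mem (n : ℕ) : (f ^ n) x ∈ (degreeLT K p.natDegree).map evalAt := by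
    refine ⟨X ^ n % p, ?_, by rw [mod_eq]; simp [evalAt]⟩
    rw [SetLike.mem_coe, mem_degreeLT, ← degree_eq_natDegree hp0]
    exact degree_mod_lt _ hp0
  have : FiniteDimensional K (degreeLT K p.natDegree) :=
    (degreeLTEquiv K p.natDegree).symm.finiteDimensional
  exact hx (Submodule.finiteDimensional_of_le (Submodule.span_le.2 (range_subset_iff.2 orbit_mem)))

theorem exists_linearIndependent_mkQ (hV : ¬ FiniteDimensional K V) (H : Submodule K V)
    [FiniteDimensional K H] (n : ℕ) : ∃ g : Fin n → V, LinearIndependent K (H.mkQ ∘ g) := by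
  have rank_quotient : Cardinal.aleph0 ≤ Module.rank K (V ⧸ H) := by
    rw [← not_lt, Module.rank_lt_aleph0_iff]
    exact fun _ => hV (Module.Finite.of_submodule_quotient H)
  obtain ⟨g, hg⟩ := exists_linearIndependent_of_le_rank
    (Cardinal.natCast_lt_aleph0.le.trans rank_quotient)
  choose g' hg' using fun i => H.mkQ_surjective (g i)
  exact ⟨g', by rwa [show H.mkQ ∘ g' = g from funext hg']⟩

theorem exists_linearIndependent_sumElim_add_smul (hV : ¬ FiniteDimensional K V) {n : ℕ}
    {b : Fin n → V} (hb : LinearIndependent K b) (c : Fin n → V) :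
    ∃ g : Fin n → V, ∀ δ : K, δ ≠ 0 →
      LinearIndependent K (Sum.elim b fun i => c i + δ • g i) := by
  let H : Submodule K V := Submodule.span K (range b ∪ range c)
  have : FiniteDimensional K H :=
    FiniteDimensional.span_of_finite K ((finite_range b).union (finite_range c))
  have hbH (i) : b i ∈ H := Submodule.subset_span (Or.inl ⟨i, rfl⟩)
  have hcH (i) : c i ∈ H := Submodule.subset_span (Or.inr ⟨i, rfl⟩)
  obtain ⟨g, hg⟩ := exists_linearIndependent_mkQ hV H n
  refine ⟨g, fun δ hδ => ?_⟩
  have hb' : LinearIndependent K fun i => (⟨b i, hbH i⟩ : H) :=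
    LinearIndependent.of_comp H.subtype hb
  have hg' : LinearIndependent K (H.mkQ ∘ fun i => c i + δ • g i) := by
    convert! hg.units_smul fun _ => Units.mk0 δ hδ using 1
    ext i
    simp [Units.smul_def, hcH i]
  exact hb'.sumElim_of_quotient _ hg'

end LinearAlgebra

section BiorthogonalSystem

variable {K V : Type*} [Field K] [AddCommGroup V] [Module K V]

/-- The biorthogonalization of a sequence `d` against functionals `φ`, the Gram–Schmidt process with
`φ j` in place of the inner product with the `j`-th output vector. -/
noncomputable def biorthogonalize (φ : ℕ → Module.Dual K V) (d : ℕ → V) (n : ℕ) : V :=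
  d n - ∑ j : Fin n, φ j (d n) • biorthogonalize φ d j
decreasing_by exact j.2

theorem apply_biorthogonalize {φ : ℕ → Module.Dual K V} {d : ℕ → V}
    (hφ₀ : ∀ i j, j < i → φ i (d j) = 0) (hφ₁ : ∀ i, φ i (d i) = 1) (i n : ℕ) :
    φ i (biorthogonalize φ d n) = if i = n then 1 else 0 := by
  induction n using Nat.strong_induction_on with
  | _ n ih =>
    have key : φ i (biorthogonalize φ d n) = φ i (d n) - if i < n then φ i (d n) else 0 := by
      rw [biorthogonalize, map_sub, map_sum, Fin.sum_univ_eq_sum_range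
        (fun j => φ i (φ j (d n) • biorthogonalize φ d j)) n]
      congr 1
      calc ∑ j ∈ Finset.range n, φ i (φ j (d n) • biorthogonalize φ d j)
          = ∑ j ∈ Finset.range n, if i = j then φ j (d n) else 0 :=
            Finset.sum_congr rfl fun j hj => by simp [ih j (Finset.mem_range.1 hj)]
        _ = if i < n then φ i (d n) else 0 := by simp
    rcases lt_trichotomy i n with h | rfl | h
    · simp [key, h, h.ne]
    · simp [key, hφ₁]
    · simp [key, h.not_gt, h.ne', hφ₀ i n h]

theorem span_le_span_biorthogonalize (φ : ℕ → Module.Dual K V) (d : ℕ → V) :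
    Submodule.span K (range d) ≤ Submodule.span K (range (biorthogonalize φ d)) := by
  refine Submodule.span_le.2 (range_subset_iff.2 fun n => ?_)
  have hd : d n = biorthogonalize φ d n + ∑ j : Fin n, φ j (d n) • biorthogonalize φ d j := by
    rw [biorthogonalize, sub_add_cancel]
  have mem (j : ℕ) : biorthogonalize φ d j ∈ Submodule.span K (range (biorthogonalize φ d)) :=
    Submodule.subset_span ⟨j, rfl⟩
  rw [SetLike.mem_coe, hd]
  exact add_mem (mem n) (sum_mem fun j _ => Submodule.smul_mem _ _ (mem j))

variable {𝕜 X : Type*} [NontriviallyNormedField 𝕜] [NormedAddCommGroup X] [NormedSpace 𝕜 X]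

theorem exists_dual_apply_eq [SeparatingDual 𝕜 X] {ι : Type*} [Finite ι] {e : ι → X}
    (he : LinearIndependent 𝕜 e) (c : ι → 𝕜) : ∃ φ : StrongDual 𝕜 X, ∀ i, φ (e i) = c i := by
  classical
  have := Fintype.ofFinite ι
  obtain ⟨φ, hφ⟩ := SeparatingDual.dualMap_surjective_iff.2
    he.fintypeLinearCombination_injective (Fintype.linearCombination 𝕜 c)
  exact ⟨φ, fun i => by simpa using LinearMap.congr_fun hφ (Pi.single i 1)⟩

variable [CompleteSpace 𝕜]

theorem finiteDimensional_of_dense {W : Submodule 𝕜 X} [FiniteDimensional 𝕜 W]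
    (hW : Dense (W : Set X)) : FiniteDimensional 𝕜 X := by
  have : W = ⊤ := by
    rw [← W.closed_of_finiteDimensional.submodule_topologicalClosure_eq]
    exact Submodule.dense_iff_topologicalClosure_eq_top.1 hW
  subst this
  exact Module.Finite.equiv Submodule.topEquiv

theorem exists_linearIndependent_dense_span [TopologicalSpace.SeparableSpace X]
    (hX : ¬ FiniteDimensional 𝕜 X) :
    ∃ d : ℕ → X, LinearIndependent 𝕜 d ∧ Dense (Submodule.span 𝕜 (range d) : Set X) := by
  obtain ⟨D, hDc, hD⟩ := TopologicalSpace.exists_countable_dense X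
  obtain ⟨b, hbD, hspan, hb⟩ := exists_linearIndependent 𝕜 D
  have hdense : Dense (Submodule.span 𝕜 b : Set X) := by
    rw [hspan]
    exact hD.mono Submodule.subset_span
  have b_infinite : b.Infinite := fun hfin =>
    have := FiniteDimensional.span_of_finite 𝕜 hfin
    hX (finiteDimensional_of_dense hdense)
  have := (hDc.mono hbD).to_subtype
  have := b_infinite.to_subtype
  obtain ⟨σ⟩ := nonempty_equiv_of_countable (α := ℕ) (β := b)
  refine ⟨Subtype.val ∘ σ, hb.comp σ σ.injective, ?_⟩
  rwa [σ.surjective.range_comp, Subtype.range_coe]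

theorem exists_biorthogonal_dense_span [SeparatingDual 𝕜 X]
    [TopologicalSpace.SeparableSpace X] (hX : ¬ FiniteDimensional 𝕜 X) :
    ∃ (x : ℕ → X) (φ : ℕ → StrongDual 𝕜 X), (∀ i j, φ i (x j) = if i = j then 1 else 0) ∧
      Dense (Submodule.span 𝕜 (range x) : Set X) := by
  obtain ⟨d, hd, hdense⟩ := exists_linearIndependent_dense_span hX
  have triangular (i : ℕ) : ∃ φ : StrongDual 𝕜 X, (∀ j < i, φ (d j) = 0) ∧ φ (d i) = 1 := by
    obtain ⟨φ, hφ⟩ := exists_dual_apply_eq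
      (hd.comp (fun j : Fin (i + 1) => (j : ℕ)) Fin.val_injective) (Pi.single (Fin.last i) 1)
    refine ⟨φ, fun j hj => ?_, by simpa using hφ (Fin.last i)⟩
    simpa [Pi.single_apply, Fin.ext_iff, hj.ne] using hφ ⟨j, by omega⟩
  choose φ hφ₀ hφ₁ using triangular
  exact ⟨biorthogonalize (fun i => φ i) d, φ, apply_biorthogonalize hφ₀ hφ₁,
    hdense.mono (span_le_span_biorthogonalize _ d)⟩

end BiorthogonalSystem

section BackwardChain

variable {𝕜 X : Type*} [NontriviallyNormedField 𝕜] [NormedAddCommGroup X] [NormedSpace 𝕜 X]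

theorem exists_ne_zero_summable_smul (𝕜 : Type*) [NontriviallyNormedField 𝕜] {E : Type*}
    [NormedAddCommGroup E] [NormedSpace 𝕜 E] [CompleteSpace E] (a : ℕ → E) :
    ∃ c : ℕ → 𝕜, (∀ k, c k ≠ 0) ∧ Summable fun k => c k • a k := by
  have hpos (k : ℕ) : 0 < (2⁻¹ ^ k / (‖a k‖ + 1) : ℝ) := by positivity
  choose c hc₀ hc using fun k => NormedField.exists_norm_lt 𝕜 (hpos k)
  refine ⟨c, fun k => norm_pos_iff.1 (hc₀ k), Summable.of_norm_bounded
    (summable_geometric_of_lt_one (r := 2⁻¹) (by norm_num) (by norm_num)) fun k => ?_⟩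
  calc ‖c k • a k‖ = ‖c k‖ * ‖a k‖ := norm_smul _ _
    _ ≤ ‖c k‖ * (‖a k‖ + 1) := by gcongr; linarith
    _ ≤ 2⁻¹ ^ k := ((lt_div_iff₀ (by positivity)).1 (hc k)).le

/-- `r` is an infinite backward chain of `K`, that is, `K` maps `⋯ ↦ r 2 ↦ r 1 ↦ r 0 ↦ 0`. -/
structure IsBackwardChain (K : X →L[𝕜] X) (r : ℕ → X) : Prop where
  map_zero : K (r 0) = 0
  map_succ (k : ℕ) : K (r (k + 1)) = r k

namespace IsBackwardChain

variable {K : X →L[𝕜] X} {r : ℕ → X}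

theorem neg (h : IsBackwardChain K r) :
    IsBackwardChain (-K) fun k => (-1 : 𝕜) ^ k • r k where
  map_zero := by simp [h.map_zero]
  map_succ k := by simp [h.map_succ, pow_succ]

theorem pow_apply (h : IsBackwardChain K r) (j k : ℕ) :
    (K ^ j) (r k) = if j ≤ k then r (k - j) else 0 := by
  induction j generalizing k with
  | zero => simp
  | succ j ih =>
    rw [pow_succ, mul_apply_eq_comp]
    cases k with
    | zero => simp [h.map_zero]
    | succ k => simp [h.map_succ, ih]

end IsBackwardChain

theorem exists_isBackwardChain_dense_span [CompleteSpace 𝕜] [SeparatingDual 𝕜 X]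
    [CompleteSpace X] [TopologicalSpace.SeparableSpace X]
    (hX : ¬ FiniteDimensional 𝕜 X) :
    ∃ (K : X →L[𝕜] X) (r : ℕ → X), IsBackwardChain K r ∧
      Dense (Submodule.span 𝕜 (range r) : Set X) := by
  obtain ⟨x, φ, hφ, hdense⟩ := exists_biorthogonal_dense_span hX
  obtain ⟨c, hc, hsum⟩ :=
    exists_ne_zero_summable_smul 𝕜 fun k => ContinuousLinearMap.smulRight (φ (k + 1)) (x k)
  let K : X →L[𝕜] X := ∑' k, c k • ContinuousLinearMap.smulRight (φ (k + 1)) (x k)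
  have hK (v : X) : HasSum (fun k => c k • φ (k + 1) v • x k) (K v) :=
    hsum.hasSum.mapL (ContinuousLinearMap.apply 𝕜 X v)
  have K_zero : K (x 0) = 0 := by
    simpa [hφ] using (hK (x 0)).tsum_eq.symm
  have K_succ (k : ℕ) : K (x (k + 1)) = c k • x k := by
    simpa [hφ] using (hK (x (k + 1))).tsum_eq.symm
  let p (k : ℕ) : 𝕜 := ∏ j ∈ Finset.range k, c j
  have hp (k : ℕ) : p k ≠ 0 := Finset.prod_ne_zero_iff.2 fun j _ => hc j
  refine ⟨K, fun k => (p k)⁻¹ • x k, ⟨by simp [K_zero], fun k => ?_⟩, hdense.mono ?_⟩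
  · rw [map_smul, K_succ, smul_smul]
    congr 1
    simp only [p, Finset.prod_range_succ]
    field_simp [hc k]
  · refine Submodule.span_le.2 (range_subset_iff.2 fun k => ?_)
    exact (Submodule.smul_mem_iff _ (inv_ne_zero (hp k))).1 (Submodule.subset_span ⟨k, rfl⟩)

end BackwardChain

section ExpBackwardChain

variable {𝕜 X : Type*} [RCLike 𝕜] [NormedAddCommGroup X] [NormedSpace 𝕜 X]

/-- The linear map sending the monomial `X ^ k` to `k! • r k`. Differentiation of polynomials then
corresponds to one step down the chain, hence translation to the exponential of that step. -/
noncomputable def chainMap (r : ℕ → X) : 𝕜[X] →ₗ[𝕜] X :=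
  (basisMonomials 𝕜).constr 𝕜 fun k => (k.factorial : 𝕜) • r k

theorem chainMap_X_pow (r : ℕ → X) (k : ℕ) :
    chainMap r (Polynomial.X ^ k : 𝕜[X]) = (k.factorial : 𝕜) • r k := by
  rw [← monomial_one_right_eq_X_pow, chainMap]
  simpa using (basisMonomials 𝕜).constr_basis 𝕜 (fun k => (k.factorial : 𝕜) • r k) k

namespace IsBackwardChain

variable {K : X →L[𝕜] X} {r : ℕ → X} [CompleteSpace X]

theorem exp_apply (h : IsBackwardChain K r) (k : ℕ) :
    NormedSpace.exp K (r k) = ∑ j ∈ Finset.range (k + 1), (j.factorial : 𝕜)⁻¹ • r (k - j) := by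
  have hexp : HasSum (fun j => (j.factorial : 𝕜)⁻¹ • (K ^ j) (r k)) (NormedSpace.exp K (r k)) :=
    (NormedSpace.exp_series_hasSum_exp' (𝕂 := 𝕜) K).mapL (ContinuousLinearMap.apply 𝕜 X (r k))
  simp only [h.pow_apply] at hexp
  rw [← hexp.tsum_eq, tsum_eq_sum (s := Finset.range (k + 1))]
  · exact Finset.sum_congr rfl fun j hj => by
      rw [if_pos (Nat.lt_succ_iff.1 (Finset.mem_range.1 hj))]
  · intro j hj
    rw [if_neg (by simpa using hj), smul_zero]

theorem exp_chainMap (h : IsBackwardChain K r) (q : 𝕜[X]) :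
    NormedSpace.exp K (chainMap r q) = chainMap r (taylor 1 q) := by
  suffices ((NormedSpace.exp K : X →L[𝕜] X) : X →ₗ[𝕜] X) ∘ₗ chainMap r =
      chainMap r ∘ₗ taylor 1 from LinearMap.congr_fun this q
  refine (basisMonomials 𝕜).ext fun k => ?_
  simp only [coe_basisMonomials, monomial_one_right_eq_X_pow, LinearMap.comp_apply,
    ContinuousLinearMap.coe_coe]
  rw [taylor_X_pow, C_1, add_comm, add_pow, chainMap_X_pow, map_smul, h.exp_apply, Finset.smul_sum,
    map_sum]
  refine Finset.sum_congr rfl fun j hj => ?_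
  have hj : j ≤ k := Nat.lt_succ_iff.1 (Finset.mem_range.1 hj)
  rw [one_pow, one_mul, mul_comm, ← C_eq_natCast, ← smul_eq_C_mul, map_smul, chainMap_X_pow,
    smul_smul, smul_smul, ← Nat.choose_mul_factorial_mul_factorial hj]
  have : (j.factorial : 𝕜) ≠ 0 := by exact_mod_cast j.factorial_ne_zero
  push_cast
  field_simp

theorem exp_pow_chainMap (h : IsBackwardChain K r) (n : ℕ) (q : 𝕜[X]) :
    (NormedSpace.exp K ^ n) (chainMap r q) = chainMap r (taylor (n : 𝕜) q) := by
  induction n with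
  | zero => simp
  | succ n ih =>
    rw [pow_succ', mul_apply_eq_comp, ih, h.exp_chainMap, taylor_taylor]
    push_cast
    rw [add_comm]

end IsBackwardChain

end ExpBackwardChain

section PolynomialFamilies

theorem continuous_map_mul_one_add_smul_pow {R A M : Type*} [CommSemiring R] [TopologicalSpace R]
    [Semiring A] [Algebra R A] [AddCommMonoid M] [Module R M] [TopologicalSpace M] [ContinuousAdd M]
    [ContinuousSMul R M] (Φ : A →ₗ[R] M) (a b : A) (k : ℕ) :
    Continuous fun s : R => Φ (a * (1 + s • b) ^ k) := by
  induction k generalizing a with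
  | zero => simpa using continuous_const
  | succ k ih =>
    have step (s : R) : Φ (a * (1 + s • b) ^ (k + 1)) =
        Φ (a * (1 + s • b) ^ k) + s • Φ (a * b * (1 + s • b) ^ k) := by
      rw [pow_succ', ← mul_assoc, mul_add, mul_one, add_mul, map_add, mul_smul_comm, smul_mul_assoc,
        map_smul]
    simp only [step]
    exact (ih a).add (continuous_id.smul (ih (a * b)))

theorem taylor_X_pow_mul_one_add_smul_X_pow {R : Type*} [CommRing R] {s t : R} (hst : s * t = -1)
    (k : ℕ) :
    taylor t (X ^ k * (1 + s • X) ^ (k + 1)) =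
      ((-1) ^ k * s) • (X ^ (k + 1) * (1 + (-s) • X) ^ k) := by
  have hC : C s * C t = (-1 : R[X]) := by rw [← C_mul, hst, C_neg, C_1]
  have cancel : 1 + C s * (X + C t) = C s * X := by linear_combination hC
  have shift : C s * (X + C t) = -(1 + C (-s) * X) := by
    rw [C_neg]
    linear_combination hC
  simp only [smul_eq_C_mul, taylor_mul, taylor_pow, map_add, taylor_one, taylor_C, taylor_X, C_1,
    cancel]
  calc (X + C t) ^ k * (C s * X) ^ (k + 1)
      = (C s * (X + C t)) ^ k * (C s * X ^ (k + 1)) := by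
        rw [mul_pow, mul_pow]; ring
    _ = C ((-1) ^ k * s) * (X ^ (k + 1) * (1 + C (-s) * X) ^ k) := by
        rw [shift, neg_pow]; simp only [map_mul, map_pow, map_neg, map_one]; ring

end PolynomialFamilies

section Mixing

variable {𝕜 X : Type*} [NontriviallyNormedField 𝕜] [NormedAddCommGroup X] [NormedSpace 𝕜 X]

/-- `S` is topologically mixing: for all nonempty open `U`, `V`, the iterate `S ^ n` maps some point
of `U` into `V` as soon as `n` is large. -/
def IsMixing (S : X →L[𝕜] X) : Prop :=
  ∀ U V : Set X, IsOpen U → U.Nonempty → IsOpen V → V.Nonempty →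
    ∀ᶠ n : ℕ in atTop, ∃ x ∈ U, (S ^ n) x ∈ V

/-- The vectors `v` that are approximately stable under `S`: some `u n → v` satisfies
`S ^ n (u n) → 0`. -/
def approxStable (S : X →L[𝕜] X) : Submodule 𝕜 X where
  carrier := {v | ∃ u : ℕ → X, Tendsto u atTop (𝓝 v) ∧ Tendsto (fun n => (S ^ n) (u n)) atTop (𝓝 0)}
  zero_mem' := ⟨0, tendsto_const_nhds, by simp⟩
  add_mem' := by
    rintro a b ⟨u, hu, hu'⟩ ⟨w, hw, hw'⟩
    exact ⟨fun n => u n + w n, hu.add hw, by simpa using hu'.add hw'⟩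
  smul_mem' := by
    rintro c a ⟨u, hu, hu'⟩
    exact ⟨fun n => c • u n, hu.const_smul c, by simpa using hu'.const_smul c⟩

theorem isMixing_of_dense_approxStable {S R : X →L[𝕜] X} (hSR : S * R = 1)
    (hS : Dense (approxStable S : Set X)) (hR : Dense (approxStable R : Set X)) : IsMixing S := by
  intro U V hU hU' hV hV'
  obtain ⟨a, haU, u, hu, hSu⟩ := hS.inter_open_nonempty U hU hU'
  obtain ⟨b, hbV, v, hv, hRv⟩ := hR.inter_open_nonempty V hV hV'
  have SR_pow (n : ℕ) : (S ^ n) ((R ^ n) (v n)) = v n := by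
    rw [← mul_apply_eq_comp, pow_mul_pow_eq_one n hSR, one_apply_eq_self]
  have start : Tendsto (fun n => u n + (R ^ n) (v n)) atTop (𝓝 a) := by simpa using hu.add hRv
  have arrival : Tendsto (fun n => (S ^ n) (u n + (R ^ n) (v n))) atTop (𝓝 b) := by
    simpa only [map_add, SR_pow, zero_add] using hSu.add hv
  filter_upwards [start.eventually (hU.mem_nhds haU), arrival.eventually (hV.mem_nhds hbV)]
    with n hn hn' using ⟨_, hn, hn'⟩

end Mixing

section MixingExp

variable {𝕜 X : Type*} [RCLike 𝕜] [NormedAddCommGroup X] [NormedSpace 𝕜 X] [CompleteSpace X]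

theorem IsBackwardChain.mem_approxStable_exp {K : X →L[𝕜] X} {r : ℕ → X} (h : IsBackwardChain K r)
    (k : ℕ) : r k ∈ approxStable (NormedSpace.exp K) := by
  -- Translation by `n` turns `1 - X / n` into `-X / n`, so `X ^ k * (1 - X / n) ^ (k + 1)` is close
  -- to `X ^ k` while its translate is `O(1 / n)`.
  let s (n : ℕ) : 𝕜 := -(n : 𝕜)⁻¹
  have hs : Tendsto s atTop (𝓝 0) := by
    simpa [s] using (tendsto_inv_atTop_nhds_zero_nat (𝕜 := 𝕜)).neg
  let u (n : ℕ) : X := chainMap r (Polynomial.X ^ k * (1 + s n • Polynomial.X) ^ (k + 1) : 𝕜[X])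
  have u_tendsto : Tendsto u atTop (𝓝 (chainMap r (Polynomial.X ^ k : 𝕜[X]))) := by
    simpa [u, Function.comp_def] using ((continuous_map_mul_one_add_smul_pow (chainMap r)
      (Polynomial.X ^ k : 𝕜[X]) Polynomial.X (k + 1)).tendsto 0).comp hs
  have exp_pow_u : ∀ᶠ n in atTop, (NormedSpace.exp K ^ n) (u n) = ((-1) ^ k * s n) •
      chainMap r (Polynomial.X ^ (k + 1) * (1 + (-s n) • Polynomial.X) ^ k : 𝕜[X]) := by
    filter_upwards [eventually_ne_atTop 0] with n hn
    have : s n * n = -1 := by simp [s, hn]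
    rw [h.exp_pow_chainMap, taylor_X_pow_mul_one_add_smul_X_pow this, map_smul]
  have exp_pow_u_tendsto : Tendsto (fun n => (NormedSpace.exp K ^ n) (u n)) atTop (𝓝 0) := by
    rw [tendsto_congr' exp_pow_u]
    have hs' := hs.neg
    rw [neg_zero] at hs'
    simpa using (hs.const_mul ((-1) ^ k)).smul (((continuous_map_mul_one_add_smul_pow (chainMap r)
      (Polynomial.X ^ (k + 1) : 𝕜[X]) Polynomial.X k).tendsto 0).comp hs')
  have mem : chainMap r (Polynomial.X ^ k : 𝕜[X]) ∈ approxStable (NormedSpace.exp K) :=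
    ⟨u, u_tendsto, exp_pow_u_tendsto⟩
  rw [chainMap_X_pow] at mem
  exact (Submodule.smul_mem_iff _ (by exact_mod_cast k.factorial_ne_zero)).1 mem

theorem IsBackwardChain.isMixing_exp {K : X →L[𝕜] X} {r : ℕ → X} (h : IsBackwardChain K r)
    (hr : Dense (Submodule.span 𝕜 (range r) : Set X)) : IsMixing (NormedSpace.exp K) := by
  have exp_mul_exp_neg : NormedSpace.exp K * NormedSpace.exp (-K) = 1 := by
    let +nondep : NormedAlgebra ℚ (X →L[𝕜] X) := .restrictScalars ℚ 𝕜 _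
    rw [← NormedSpace.exp_add_of_commute (Commute.refl K).neg_right, add_neg_cancel,
      NormedSpace.exp_zero]
  refine isMixing_of_dense_approxStable exp_mul_exp_neg (hr.mono ?_) (hr.mono ?_)
  · exact Submodule.span_le.2 (range_subset_iff.2 h.mem_approxStable_exp)
  · refine Submodule.span_le.2 (range_subset_iff.2 fun k => ?_)
    exact (Submodule.smul_mem_iff _ (pow_ne_zero k (by simp))).1 (h.neg.mem_approxStable_exp k)

theorem exists_isMixing [TopologicalSpace.SeparableSpace X] (hX : ¬ FiniteDimensional 𝕜 X) :
    ∃ S : X →L[𝕜] X, IsMixing S := by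
  obtain ⟨K, r, h, hr⟩ := exists_isBackwardChain_dense_span hX
  exact ⟨NormedSpace.exp K, h.isMixing_exp hr⟩

end MixingExp

section Residual

theorem eventually_residual_dense_range {ι α Y : Type*} [TopologicalSpace α] [TopologicalSpace Y]
    [SecondCountableTopology Y] {u : ι → α → Y} (hu : ∀ n, Continuous (u n))
    (h : ∀ W : Set Y, IsOpen W → W.Nonempty → Dense {a | ∃ n, u n a ∈ W}) :
    ∀ᶠ a in residual α, Dense (range fun n => u n a) := by
  obtain ⟨B, hBc, hB₀, hB⟩ := TopologicalSpace.exists_countable_basis Y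
  have meets_basis : ∀ᶠ a in residual α, ∀ W ∈ B, ∃ n, u n a ∈ W := by
    refine (eventually_countable_ball hBc).2 fun W hW => residual_of_dense_open ?_ ?_
    · simp only [ofPred_exists]
      exact isOpen_iUnion fun n => (hB.isOpen hW).preimage (hu n)
    · exact h W (hB.isOpen hW) (nonempty_iff_ne_empty.2 fun hempty => hB₀ (hempty ▸ hW))
  filter_upwards [meets_basis] with a ha
  refine hB.dense_iff.2 fun W hW _ => ?_
  obtain ⟨n, hn⟩ := ha W hW
  exact ⟨u n a, hn, n, rfl⟩

variable {𝕜 X : Type*} [NontriviallyNormedField 𝕜] [NormedAddCommGroup X] [NormedSpace 𝕜 X]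
  [CompleteSpace X]

theorem IsMixing.exists_dense_orbit [TopologicalSpace.SeparableSpace X] {S : X →L[𝕜] X}
    (hS : IsMixing S) : ∃ x, Dense (range fun n : ℕ => (S ^ n) x) := by
  have : SecondCountableTopology X := UniformSpace.secondCountable_of_separable X
  refine (dense_of_mem_residual (eventually_residual_dense_range (fun n => (S ^ n).continuous)
    fun W hW hW' => dense_iff_inter_open.2 fun U hU hU' => ?_)).nonempty
  obtain ⟨n, x, hxU, hxW⟩ := (hS U W hU hU' hW hW').exists
  exact ⟨x, hxU, n, hxW⟩

theorem IsMixing.exists_linearIndependent_sumElim [CompleteSpace 𝕜]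
    [TopologicalSpace.SeparableSpace X] (hX : ¬ FiniteDimensional 𝕜 X) {S : X →L[𝕜] X}
    (hS : IsMixing S) : ∃ e : ℕ → X, LinearIndependent 𝕜 (Sum.elim e (S ∘ e)) := by
  obtain ⟨x, hx⟩ := hS.exists_dense_orbit
  have orbit : LinearIndependent 𝕜 fun n : ℕ => (S ^ n) x := by
    have coe_pow (n : ℕ) : (S ^ n) x = ((S : Module.End 𝕜 X) ^ n) x := by
      rw [← ContinuousLinearMap.toLinearMap_pow, ContinuousLinearMap.coe_coe]
    simp only [coe_pow] at hx ⊢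
    exact linearIndependent_pow_apply fun _ =>
      hX (finiteDimensional_of_dense (hx.mono Submodule.subset_span))
  refine ⟨fun i => (S ^ (2 * i)) x, ?_⟩
  convert! orbit.comp Equiv.natSumNatEquivNat Equiv.natSumNatEquivNat.injective using 1
  ext (i | i)
  · simp
  · change S ((S ^ (2 * i)) x) = (S ^ (2 * i + 1)) x
    rw [pow_succ', mul_apply_eq_comp]

end Residual

section Conjugation

variable {𝕜 X : Type*} [NontriviallyNormedField 𝕜] [NormedAddCommGroup X] [NormedSpace 𝕜 X]

/-- The conjugate `L⁻¹ S L` of the operator `S` by an invertible operator `L`. -/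
def conj (S : X →L[𝕜] X) (L : (X →L[𝕜] X)ˣ) : X →L[𝕜] X :=
  ↑L⁻¹ * S * ↑L

theorem conj_pow_apply (S : X →L[𝕜] X) (L : (X →L[𝕜] X)ˣ) (n : ℕ) (x : X) :
    (conj S L ^ n) x = (↑L⁻¹ : X →L[𝕜] X) ((S ^ n) ((L : X →L[𝕜] X) x)) := by
  rw [conj, Units.conj_pow']
  rfl

theorem continuous_conj (S : X →L[𝕜] X) : Continuous (conj S) :=
  ((Units.continuous_val.comp continuous_inv).mul continuous_const).mul Units.continuous_val

theorem units_inv_apply_apply (L : (X →L[𝕜] X)ˣ) (x : X) :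
    (↑L⁻¹ : X →L[𝕜] X) ((L : X →L[𝕜] X) x) = x := by
  rw [← mul_apply_eq_comp, L.inv_mul, one_apply_eq_self]

variable [CompleteSpace X] [SeparatingDual 𝕜 X]

theorem isOpenMap_units_apply {x : X} (hx : x ≠ 0) :
    IsOpenMap fun L : (X →L[𝕜] X)ˣ => (L : X →L[𝕜] X) x := by
  obtain ⟨φ, hφ⟩ := SeparatingDual.exists_eq_one (R := 𝕜) hx
  have apply_surjective : Function.Surjective (ContinuousLinearMap.apply 𝕜 X x) := fun y =>
    ⟨φ.smulRight y, by simp [hφ]⟩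
  exact (ContinuousLinearMap.isOpenMap _ apply_surjective).comp Units.isOpenMap_val

theorem IsMixing.dense_setOf_conj_mem {S : X →L[𝕜] X} (hS : IsMixing S) {x : X} (hx : x ≠ 0)
    {I : Set ℕ} (hI : ∃ᶠ n in atTop, n ∈ I) {V : Set X} (hV : IsOpen V) (hV' : V.Nonempty) :
    Dense {L : (X →L[𝕜] X)ˣ | ∃ n ∈ I, (conj S L ^ n) x ∈ V} := by
  obtain ⟨y, hy⟩ := hV'
  refine dense_iff_inter_open.2 fun O hO ⟨L₀, hL₀⟩ => ?_
  have inv_apply_continuous :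
      Continuous fun p : (X →L[𝕜] X)ˣ × X => (↑p.1⁻¹ : X →L[𝕜] X) p.2 :=
    (Units.continuous_val.comp (continuous_inv.comp continuous_fst)).clm_apply continuous_snd
  obtain ⟨O', Z, hO', hZ, hL₀', hyZ, hOZ⟩ := isOpen_prod_iff.1
    ((hO.preimage continuous_fst).inter (hV.preimage inv_apply_continuous)) L₀
    ((L₀ : X →L[𝕜] X) y) ⟨hL₀, by simpa [units_inv_apply_apply] using hy⟩
  obtain ⟨n, ⟨_, ⟨L, hL, rfl⟩, hnZ⟩, hn⟩ := ((hS _ _ (isOpenMap_units_apply hx _ hO')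
    ⟨_, mem_image_of_mem _ hL₀'⟩ hZ ⟨_, hyZ⟩).and_frequently hI).exists
  have hLn := hOZ (mk_mem_prod hL hnZ)
  exact ⟨L, hLn.1, n, hn, by rw [conj_pow_apply]; exact hLn.2⟩

end Conjugation

section DisjointHypercyclicVectors

variable {𝕜 X : Type*} [RCLike 𝕜] [NormedAddCommGroup X] [NormedSpace 𝕜 X] {N : ℕ}
  {T : Fin N → X →L[𝕜] X} {x : X}

theorem frequently_mem_of_mem_dHC [Nontrivial X] (hx : x ∈ dHC T) {U : Set (Fin N → X)}
    (hU : IsOpen U) (hU' : U.Nonempty) : ∃ᶠ n in atTop, (fun i => (T i ^ n) x) ∈ U := by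
  rcases isEmpty_or_nonempty (Fin N) with _ | _
  · rw [Subsingleton.eq_univ_of_nonempty hU']
    exact Frequently.of_forall fun n => mem_univ _
  have (y : Fin N → X) : NeBot (𝓝[≠] y) := Module.punctured_nhds_neBot 𝕜 (Fin N → X) y
  refine frequently_atTop.2 fun m => ?_
  have initial_finite : ((fun n i => (T i ^ n) x) '' Iio m).Finite := (finite_Iio m).image _
  obtain ⟨_, hnU, ⟨n, rfl⟩, hn⟩ :=
    (Dense.sdiff_finite hx initial_finite).inter_open_nonempty U hU hU'
  exact ⟨n, not_lt.1 fun hnm => hn ⟨n, hnm, rfl⟩, hnU⟩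

theorem mem_dHC_extend {S : X →L[𝕜] X}
    (hx : Dense (range fun n : ℕ => ((fun i => (T i ^ n) x, (S ^ n) x) : (Fin N → X) × X))) :
    x ∈ dHC (extend T S) := by
  let snoc (q : (Fin N → X) × X) : Fin (N + 1) → X := Fin.snoc (α := fun _ => X) q.1 q.2
  have snoc_continuous : Continuous snoc :=
    Continuous.finSnoc (A := fun _ => X) continuous_fst continuous_snd
  have snoc_surjective : Function.Surjective snoc := fun y =>
    ⟨(Fin.init y, y (Fin.last N)), Fin.snoc_init_self y⟩
  have orbit_eq (n : ℕ) : (fun i => (extend T S i ^ n) x) =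
      snoc (fun i => (T i ^ n) x, (S ^ n) x) := by
    funext i
    refine Fin.lastCases ?_ (fun i => ?_) i <;> simp [extend, snoc]
  change Dense (range fun (n : ℕ) i => (extend T S i ^ n) x)
  rw [funext orbit_eq]
  exact snoc_surjective.denseRange.comp hx snoc_continuous

variable [CompleteSpace X] [TopologicalSpace.SeparableSpace X]

theorem IsMixing.eventually_residual_mem_dHC_extend_conj {S : X →L[𝕜] X} (hS : IsMixing S)
    (hx : x ∈ dHC T) (hx₀ : x ≠ 0) :
    ∀ᶠ L in residual (X →L[𝕜] X)ˣ, x ∈ dHC (extend T (conj S L)) := by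
  have : Nontrivial X := ⟨x, 0, hx₀⟩
  have : SecondCountableTopology X := UniformSpace.secondCountable_of_separable X
  refine (eventually_residual_dense_range (fun n => ?_) fun W hW hW' => ?_).mono
    fun L => mem_dHC_extend
  · exact continuous_const.prodMk (((continuous_conj S).pow n).clm_apply continuous_const)
  · obtain ⟨⟨y, z⟩, hyz⟩ := hW'
    obtain ⟨U, V, hU, hV, hyU, hzV, hUV⟩ := isOpen_prod_iff.1 hW y z hyz
    refine (hS.dense_setOf_conj_mem hx₀ (frequently_mem_of_mem_dHC hx hU ⟨y, hyU⟩) hV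
      ⟨z, hzV⟩).mono ?_
    rintro L ⟨n, hnU, hnV⟩
    exact ⟨n, hUV (mk_mem_prod hnU hnV)⟩

end DisjointHypercyclicVectors

section StrongOperatorDensity

variable {𝕜 X : Type*} [RCLike 𝕜] [NormedAddCommGroup X] [NormedSpace 𝕜 X]

theorem exists_unit_extending {M : Submodule 𝕜 X} [FiniteDimensional 𝕜 M] (g : M ≃ₗ[𝕜] M) :
    ∃ L : (X →L[𝕜] X)ˣ, ∀ v : M, (L : X →L[𝕜] X) v = g v := by
  obtain ⟨M', e, he, -, he_symm⟩ :=
    (Submodule.ClosedComplemented.of_finiteDimensional M).exists_submodule_equiv_prod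
  refine ⟨((e.trans (g.toContinuousLinearEquiv.prodCongr (.refl 𝕜 M'))).trans e.symm).toUnit,
    fun v => ?_⟩
  change e.symm (g.toContinuousLinearEquiv.prodCongr (.refl 𝕜 M') (e v)) = g v
  simp [he, he_symm]

theorem exists_unit_apply_eq {ι : Type*} [Finite ι] {a b : ι → X} (ha : LinearIndependent 𝕜 a)
    (hb : LinearIndependent 𝕜 b) : ∃ L : (X →L[𝕜] X)ˣ, ∀ i, (L : X →L[𝕜] X) (a i) = b i := by
  let M : Submodule 𝕜 X := Submodule.span 𝕜 (range a ∪ range b)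
  have : FiniteDimensional 𝕜 M :=
    FiniteDimensional.span_of_finite 𝕜 ((finite_range a).union (finite_range b))
  let a' (i : ι) : M := ⟨a i, Submodule.subset_span (Or.inl ⟨i, rfl⟩)⟩
  let b' (i : ι) : M := ⟨b i, Submodule.subset_span (Or.inr ⟨i, rfl⟩)⟩
  have ha' : LinearIndependent 𝕜 a' := LinearIndependent.of_comp M.subtype ha
  have hb' : LinearIndependent 𝕜 b' := LinearIndependent.of_comp M.subtype hb
  obtain ⟨g, hg⟩ := Submodule.exists_linearEquiv_restrict_eq
    ((Module.Basis.span ha').equiv (Module.Basis.span hb') (Equiv.refl ι))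
  have g_apply (i : ι) : g (a' i) = b' i := by
    have h := hg (Module.Basis.span ha' i)
    rw [Module.Basis.equiv_apply, Module.Basis.span_apply, Module.Basis.span_apply] at h
    exact h.symm
  obtain ⟨L, hL⟩ := exists_unit_extending g
  exact ⟨L, fun i => (hL (a' i)).trans (congrArg Subtype.val (g_apply i))⟩

theorem exists_units_tendsto_conj_apply (hX : ¬ FiniteDimensional 𝕜 X) {S : X →L[𝕜] X} {e : ℕ → X}
    (he : LinearIndependent 𝕜 (Sum.elim e (S ∘ e))) (R : X →L[𝕜] X) (W : Submodule 𝕜 X)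
    [FiniteDimensional 𝕜 W] : ∃ L : ℕ → (X →L[𝕜] X)ˣ,
      ∀ v ∈ W, Tendsto (fun n => conj S (L n) v) atTop (𝓝 (R v)) := by
  let b := Module.finBasis 𝕜 W
  have hb : LinearIndependent 𝕜 fun i => (b i : X) :=
    b.linearIndependent.map' W.subtype W.ker_subtype
  let d := Module.finrank 𝕜 W
  have he' : LinearIndependent 𝕜
      (Sum.elim (fun i : Fin d => e i) fun i : Fin d => S (e i)) := by
    have h := he.comp (Sum.map (Fin.val (n := d)) (Fin.val (n := d)))
      (Fin.val_injective.sumMap Fin.val_injective)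
    rwa [Sum.elim_comp_map] at h
  obtain ⟨g, hg⟩ := exists_linearIndependent_sumElim_add_smul hX hb fun i => R (b i)
  let δ (n : ℕ) : 𝕜 := 1 / (n + 1)
  have hδ : Tendsto δ atTop (𝓝 0) := tendsto_one_div_add_atTop_nhds_zero_nat
  choose L hL using fun n => exists_unit_apply_eq
    (hg (δ n) (one_div_ne_zero (Nat.cast_add_one_ne_zero n))) he'
  have conj_basis (n i) : conj S (L n) (b i) = R (b i) + δ n • g i := by
    have hbi : (L n : X →L[𝕜] X) (b i) = e i := hL n (Sum.inl i)
    have hRi : (L n : X →L[𝕜] X) (R (b i) + δ n • g i) = S (e i) := hL n (Sum.inr i)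
    rw [← pow_one (conj S (L n)), conj_pow_apply, pow_one, hbi, ← hRi, units_inv_apply_apply]
  have tendsto_basis (i) : Tendsto (fun n => conj S (L n) (b i)) atTop (𝓝 (R (b i))) := by
    simpa only [conj_basis, zero_smul, add_zero] using (hδ.smul_const (g i)).const_add (R (b i))
  refine ⟨L, fun v hv => ?_⟩
  have expand (F : X →L[𝕜] X) : F v = ∑ i, b.repr ⟨v, hv⟩ i • F (b i) :=
    (congrArg (F ∘L W.subtypeL) (b.sum_repr ⟨v, hv⟩)).symm.trans
      (by simp only [map_sum, map_smul]; rfl)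
  simp only [expand]
  exact tendsto_finsetSum _ fun i _ => (tendsto_basis i).const_smul _

theorem denseRange_toPointwiseConvergenceCLM_conj (hX : ¬ FiniteDimensional 𝕜 X) {S : X →L[𝕜] X}
    {e : ℕ → X} (he : LinearIndependent 𝕜 (Sum.elim e (S ∘ e))) :
    DenseRange fun L => ContinuousLinearMap.toPointwiseConvergenceCLM 𝕜 (RingHom.id 𝕜) X X
      (conj S L) := by
  intro R
  rw [(PointwiseConvergenceCLM.isEmbedding_coeFn (RingHom.id 𝕜) X X).isInducing
    |>.closure_eq_preimage_closure_image, mem_preimage, mem_closure_iff_nhds]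
  intro t ht
  rw [nhds_pi] at ht
  obtain ⟨I, hI, u, hu, hut⟩ := Filter.mem_pi.1 ht
  have : FiniteDimensional 𝕜 (Submodule.span 𝕜 I) := FiniteDimensional.span_of_finite 𝕜 hI
  obtain ⟨L, hL⟩ := exists_units_tendsto_conj_apply hX he R (Submodule.span 𝕜 I)
  have conj_mem : ∀ᶠ n in atTop, ∀ v ∈ I, conj S (L n) v ∈ u v :=
    (eventually_all_finite hI).2 fun v hv => (hL v (Submodule.subset_span hv)) (hu v)
  obtain ⟨n, hn⟩ := conj_mem.exists
  exact ⟨_, hut hn, mem_image_of_mem _ (mem_range_self (L n))⟩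

end StrongOperatorDensity

end DisjointHypercyclic

open DisjointHypercyclic Filter Topology Set in
theorem corollary2p4_general {𝕜 X : Type*} [RCLike 𝕜] [NormedAddCommGroup X] [NormedSpace 𝕜 X]
    [CompleteSpace X] [TopologicalSpace.SeparableSpace X] (hX : ¬ FiniteDimensional 𝕜 X) {N : ℕ}
    {T : Fin N → X →L[𝕜] X} (hT : DenselyDHypercyclic T) {A : Set X} (hA : A.Countable)
    (hA₀ : 0 ∉ A) (hAT : A ⊆ dHC T) :
    SOTDense {S : X →L[𝕜] X | DenselyDHypercyclic (extend T S) ∧ A ⊆ dHC (extend T S)} := by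
  have : Nontrivial X := not_subsingleton_iff_nontrivial.1 fun _ => hX inferInstance
  have : NeBot (𝓝[≠] (0 : X)) := Module.punctured_nhds_neBot 𝕜 X 0
  have : SecondCountableTopology X := UniformSpace.secondCountable_of_separable X
  have : BaireSpace (X →L[𝕜] X)ˣ := Units.isOpenEmbedding_val.baireSpace
  obtain ⟨S, hS⟩ := exists_isMixing hX
  obtain ⟨e, he⟩ := hS.exists_linearIndependent_sumElim hX
  obtain ⟨D, hDT, hDc, hD⟩ := (hT.sdiff_singleton 0).exists_countable_dense_subset
  have good : ∀ᶠ L in residual (X →L[𝕜] X)ˣ, ∀ x ∈ A ∪ D, x ∈ dHC (extend T (conj S L)) :=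
    (eventually_countable_ball (hA.union hDc)).2 fun x hx =>
      hS.eventually_residual_mem_dHC_extend_conj (hx.elim (@hAT x) fun hxD => (hDT hxD).1)
        (hx.elim (fun hxA => ne_of_mem_of_not_mem hxA hA₀) fun hxD => (hDT hxD).2)
  refine ((denseRange_toPointwiseConvergenceCLM_conj hX he).dense_image
    ((map_continuous (ContinuousLinearMap.toPointwiseConvergenceCLM 𝕜 (RingHom.id 𝕜) X X)).comp
      (continuous_conj S)) (dense_of_mem_residual good)).mono ?_
  rintro _ ⟨L, hL, rfl⟩
  exact mem_image_of_mem _ ⟨hD.mono fun x hx => hL x (Or.inr hx), fun x hx => hL x (Or.inl hx)⟩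

theorem corollary2p4 {𝕜 X : Type*} [RCLike 𝕜]
    [NormedAddCommGroup X] [NormedSpace 𝕜 X] [CompleteSpace X]
    [TopologicalSpace.SeparableSpace X] (hX : ¬ FiniteDimensional 𝕜 X)
    {N : ℕ} (hN : 1 ≤ N) (T : Fin N → X →L[𝕜] X)
    (hT : DisjointHypercyclic.DenselyDHypercyclic T) :
    DisjointHypercyclic.SOTDense {S : X →L[𝕜] X |
      DisjointHypercyclic.DenselyDHypercyclic (DisjointHypercyclic.extend T S)} ∧
    ∀ A : Set X, A.Countable → LinearIndepOn 𝕜 id A → A ⊆ DisjointHypercyclic.dHC T →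
      ∃ C : Set (X →L[𝕜] X),
        C ⊆ {S : X →L[𝕜] X |
          DisjointHypercyclic.DenselyDHypercyclic (DisjointHypercyclic.extend T S)} ∧
        DisjointHypercyclic.SOTDense C ∧
        ∀ S ∈ C, A ⊆ DisjointHypercyclic.dHC (DisjointHypercyclic.extend T S) := by
  refine ⟨?_, fun A hA hAlin hAT => ⟨_, fun S hS => hS.1, corollary2p4_general hX hT hA
    (fun h₀ => hAlin.ne_zero h₀ rfl) hAT, fun S hS => hS.2⟩⟩
  exact (corollary2p4_general hX hT Set.countable_empty (Set.notMem_empty 0)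
    (Set.empty_subset _)).mono (Set.image_mono fun S hS => hS.1)
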